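/- Let $p$ be an odd prime, let $n\ge 3$ be an integer, and let $F$ be a field containing a primitive $p$-th root of unity $\zeta$, which we fix. Let $G_F$ be the absolute Galois group of $F$, and let $H^i(G_F,\mathbb F_p)$ be the cohomology of the inhomogeneous continuous cochain complex $(\mathcal C^\bullet(G_F,\mathbb F_p),\delta)$ with coefficients in the trivial discrete module $\mathbb F_p$. For $a\in F^\times$ let $\chi_a\in H^1(G_F,\mathbb F_p)=\mathrm{Hom}_{\mathrm{cont}}(G_F,\mathbb F_p)$ be the Kummer character, defined by $\sigma(\sqrt[p]{a})=\zeta^{\chi_a(\sigma)}\sqrt[p]{a}$ for $\sigma\in G_F$. Put $F^p=\{c^p : c\in F\}$. Assume that $F$ is $p$-rigid, that is: for every $a\in F\setminus F^p$ and every $b\in F^\times$, if $\chi_a\cup\chi_b=0$ in $H^2(G_F,\mathbb F_p)$, then $b\in a^iF^p$ for some integer $i\ge 0$. For $\alpha_1,\dots,\alpha_n\in H^1(G_F,\mathbb F_p)$, a defining system is a collection $M=(a_{ij})$, $1\le i<j\le n+1$, $(i,j)\ne(1,n+1)$, of elements of $\mathcal C^1(G_F,\mathbb F_p)$ such that $a_{i,i+1}$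 represents $\alpha_i$ for $1\le i\le n$ and $\delta a_{ij}=\sum_{l=i+1}^{j-1}a_{il}\cup a_{lj}$ whenever $i+1<j$ (and $(i,j)\neq(1,n+1)$). Its value is the class in $H^2(G_F,\mathbb F_p)$ of the $2$-cocycle $\sum_{k=2}^{n}a_{1k}\cup a_{k,n+1}$. The $n$-fold Massey product $\langle\alpha_1,\dots,\alpha_n\rangle\subseteq H^2(G_F,\mathbb F_p)$ is the set of values of all defining systems, and it is said to be defined if at least one defining system exists. Theorem. For all $\alpha_1,\dots,\alpha_n\in H^1(G_F,\mathbb F_p)$, if the Massey product $\langle\alpha_1,\dots,\alpha_n\rangle$ is defined, then $0\in\langle\alpha_1,\dots,\alpha_n\rangle$. -/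

import Mathlib

namespace MasseyRigid

noncomputable section

section Cohomology

/-! Low degrees of the standard inhomogeneous continuous cochain complex of a topological group
`G` with coefficients in the trivial discrete `G`-module `𝔽_p`, and its cohomology. -/

variable (p : ℕ) (G : Type*) [Group G] [TopologicalSpace G] [IsTopologicalGroup G]

/-- Continuous inhomogeneous `1`-cochains with values in `𝔽_p` (with the discrete topology). -/
abbrev C1 := C(G, ZMod p)

/-- Continuous inhomogeneous `2`-cochains. -/
abbrev C2 := C(G × G, ZMod p)

/-- Continuous inhomogeneous `3`-cochains. -/
abbrev C3 := C(G × G × G, ZMod p)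

/-- The coboundary of a `0`-cochain, `(δ m)(g) = g • m - m`, where `g • m = m`. -/
def d0 : ZMod p →ₗ[ZMod p] C1 p G where
  toFun m := ⟨fun _ => m - m, continuous_const⟩
  map_add' m m' := by ext g; simp
  map_smul' c m := by ext g; simp

/-- The coboundary of a `1`-cochain, `(δ f)(g, h) = f(h) - f(gh) + f(g)`. -/
def d1 : C1 p G →ₗ[ZMod p] C2 p G where
  toFun f := ⟨fun x => f x.2 - f (x.1 * x.2) + f x.1, by fun_prop⟩
  map_add' f f' := by ext x; simp; ring
  map_smul' c f := by ext x; simp; ring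

/-- The coboundary of a `2`-cochain,
`(δ f)(g, h, k) = f(h, k) - f(gh, k) + f(g, hk) - f(g, h)`. -/
def d2 : C2 p G →ₗ[ZMod p] C3 p G where
  toFun f := ⟨fun x => f (x.2.1, x.2.2) - f (x.1 * x.2.1, x.2.2) + f (x.1, x.2.1 * x.2.2)
    - f (x.1, x.2.1), by fun_prop⟩
  map_add' f f' := by ext x; simp; ring
  map_smul' c f := by ext x; simp; ring

/-- Continuous `1`-cocycles. -/
abbrev Z1 : Submodule (ZMod p) (C1 p G) := LinearMap.ker (d1 p G)

/-- Continuous `2`-cocycles. -/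
abbrev Z2 : Submodule (ZMod p) (C2 p G) := LinearMap.ker (d2 p G)

/-- `1`-coboundaries, as a submodule of the `1`-cocycles. -/
abbrev B1 : Submodule (ZMod p) (Z1 p G) := (LinearMap.range (d0 p G)).comap (Z1 p G).subtype

/-- `2`-coboundaries, as a submodule of the `2`-cocycles. -/
abbrev B2 : Submodule (ZMod p) (Z2 p G) := (LinearMap.range (d1 p G)).comap (Z2 p G).subtype

/-- `H¹(G, 𝔽_p)`. -/
abbrev H1 := Z1 p G ⧸ B1 p G

/-- `H²(G, 𝔽_p)`. -/
abbrev H2 := Z2 p G ⧸ B2 p G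

variable {p G}

lemma mem_Z1 (f : C1 p G) : f ∈ Z1 p G ↔ ∀ g h, f (g * h) = f g + f h := by
  rw [LinearMap.mem_ker, ContinuousMap.ext_iff, Prod.forall]
  refine forall₂_congr fun g h => ?_
  change f h - f (g * h) + f g = 0 ↔ _
  constructor <;> intro H <;> linear_combination -H

/-- The cup product of two `1`-cochains, `(a ∪ b)(g, h) = a(g) b(h)`. -/
def cup (a b : C1 p G) : C2 p G := ⟨fun x => a x.1 * b x.2, by fun_prop⟩

lemma cup_mem_Z2 {a b : C1 p G} (ha : a ∈ Z1 p G) (hb : b ∈ Z1 p G) : cup a b ∈ Z2 p G := by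
  rw [mem_Z1] at ha hb
  rw [LinearMap.mem_ker]
  ext ⟨g, h, k⟩
  change a h * b k - a (g * h) * b k + a g * b (h * k) - a g * b h = 0
  rw [ha, hb]; ring

lemma B1_eq_bot : B1 p G = ⊥ := by
  rw [eq_bot_iff]
  rintro ⟨f, hf⟩ ⟨m, hm⟩
  rw [Submodule.mem_bot, Subtype.ext_iff]
  change f = 0
  rw [← show d0 p G m = f from hm]
  ext g
  exact sub_self m

/-- The cup product `H¹(G, 𝔽_p) × H¹(G, 𝔽_p) → H²(G, 𝔽_p)`, induced by the cup product of
cocycles. -/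
def cupH (α β : H1 p G) : H2 p G :=
  Quotient.liftOn₂ α β
    (fun a b => (B2 p G).mkQ ⟨cup a.1 b.1, cup_mem_Z2 a.2 b.2⟩) (by
      intro a b a' b' h h'
      have e : ∀ x y : Z1 p G, (B1 p G).quotientRel x y → x = y := by
        intro x y hxy
        rw [Submodule.quotientRel_def, B1_eq_bot, Submodule.mem_bot, sub_eq_zero] at hxy
        exact hxy
      rw [e a a' h, e b b' h'])

/-- A cochain `a` represents the class `α ∈ H¹(G, 𝔽_p)`. -/
def Represents (a : C1 p G) (α : H1 p G) : Prop :=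
  ∃ h : a ∈ Z1 p G, (B1 p G).mkQ ⟨a, h⟩ = α

/-- A defining system for the `n`-fold Massey product `⟨α₁, …, αₙ⟩`. The indices `1, …, n + 1` are
shifted to `0, …, n`, so `α i` sits at the position `(i, i + 1)`. Only the entries `a i j` with
`i < j` and `(i, j) ≠ (0, n)` matter. -/
structure DefiningSystem {n : ℕ} (α : Fin n → H1 p G) where
  /-- The entries of the system. -/
  a : Fin (n + 1) → Fin (n + 1) → C1 p G
  represents : ∀ i : Fin n, Represents (a i.castSucc i.succ) (α i)
  coboundary : ∀ i j : Fin (n + 1), (i : ℕ) + 1 < j → (i, j) ≠ (0, Fin.last n) →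
    d1 p G (a i j) = ∑ l ∈ Finset.Ioo i j, cup (a i l) (a l j)

namespace DefiningSystem

variable {n : ℕ} {α : Fin n → H1 p G}

lemma d1_a (M : DefiningSystem α) (i j : Fin (n + 1)) (hij : i < j)
    (h : (i, j) ≠ (0, Fin.last n)) :
    d1 p G (M.a i j) = ∑ l ∈ Finset.Ioo i j, cup (M.a i l) (M.a l j) := by
  rcases Nat.lt_or_ge ((i : ℕ) + 1) j with h1 | h1
  · exact M.coboundary i j h1 h
  · have hij' : (i : ℕ) < j := hij
    have hi : (i : ℕ) < n := by omega
    have e1 : i = (⟨i, hi⟩ : Fin n).castSucc := rfl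
    have e2 : j = (⟨i, hi⟩ : Fin n).succ := by ext; simp; omega
    have he : Finset.Ioo i j = ∅ := by
      ext l
      simp only [Finset.mem_Ioo, Fin.lt_def, Finset.notMem_empty, iff_false]
      omega
    rw [he, Finset.sum_empty]
    obtain ⟨hz, -⟩ := M.represents ⟨i, hi⟩
    rw [← e2] at hz
    exact hz

/-- The `2`-cochain `∑ a_{1k} ∪ a_{k,n+1}`, `2 ≤ k ≤ n`. -/
def cochain (M : DefiningSystem α) : C2 p G :=
  ∑ l ∈ Finset.Ioo 0 (Fin.last n), cup (M.a 0 l) (M.a l (Fin.last n))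

lemma cochain_mem_Z2 (M : DefiningSystem α) : M.cochain ∈ Z2 p G := by
  have key : ∀ i j : Fin (n + 1), i < j → (i, j) ≠ (0, Fin.last n) → ∀ g h : G,
      M.a i j (g * h) = M.a i j g + M.a i j h
        - ∑ l ∈ Finset.Ioo i j, M.a i l g * M.a l j h := by
    intro i j hij hne g h
    have := DFunLike.congr_fun (M.d1_a i j hij hne) (g, h)
    rw [ContinuousMap.sum_apply] at this
    change M.a i j h - M.a i j (g * h) + M.a i j g
      = ∑ l ∈ Finset.Ioo i j, M.a i l g * M.a l j h at this
    linear_combination -this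
  have hv : ∀ g h : G, M.cochain (g, h)
      = ∑ l ∈ Finset.Ioo 0 (Fin.last n), M.a 0 l g * M.a l (Fin.last n) h := by
    intro g h
    rw [cochain, ContinuousMap.sum_apply]
    rfl
  rw [LinearMap.mem_ker]
  ext ⟨g, h, k⟩
  change M.cochain (h, k) - M.cochain (g * h, k) + M.cochain (g, h * k) - M.cochain (g, h) = 0
  rw [hv, hv, hv, hv, ← Finset.sum_sub_distrib, ← Finset.sum_add_distrib,
    ← Finset.sum_sub_distrib]
  have step : ∀ l ∈ Finset.Ioo 0 (Fin.last n),
      M.a 0 l h * M.a l (Fin.last n) k - M.a 0 l (g * h) * M.a l (Fin.last n) k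
        + M.a 0 l g * M.a l (Fin.last n) (h * k) - M.a 0 l g * M.a l (Fin.last n) h
      = (∑ m ∈ Finset.Ioo 0 l, M.a 0 m g * M.a m l h * M.a l (Fin.last n) k)
        - ∑ m ∈ Finset.Ioo l (Fin.last n), M.a 0 l g * M.a l m h * M.a m (Fin.last n) k := by
    intro l hl
    rw [Finset.mem_Ioo] at hl
    rw [key 0 l hl.1 (by simp [hl.2.ne]), key l (Fin.last n) hl.2 (by simp [hl.1.ne'])]
    have e1 : ∑ m ∈ Finset.Ioo 0 l, M.a 0 m g * M.a m l h * M.a l (Fin.last n) k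
        = (∑ m ∈ Finset.Ioo 0 l, M.a 0 m g * M.a m l h) * M.a l (Fin.last n) k := by
      rw [Finset.sum_mul]
    have e2 : ∑ m ∈ Finset.Ioo l (Fin.last n), M.a 0 l g * M.a l m h * M.a m (Fin.last n) k
        = M.a 0 l g * ∑ m ∈ Finset.Ioo l (Fin.last n), M.a l m h * M.a m (Fin.last n) k := by
      rw [Finset.mul_sum]
      exact Finset.sum_congr rfl fun m _ => by ring
    rw [e1, e2]; ring
  rw [Finset.sum_congr rfl step, Finset.sum_sub_distrib, sub_eq_zero]
  refine Finset.sum_comm' ?_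
  intro x y
  simp only [Finset.mem_Ioo]
  constructor
  · rintro ⟨⟨h1, h2⟩, h3, h4⟩
    exact ⟨⟨h4, h2⟩, h3, h4.trans h2⟩
  · rintro ⟨⟨h1, h2⟩, h3, h4⟩
    exact ⟨⟨h3.trans h1, h2⟩, h3, h1⟩

/-- The value of the Massey product relative to the defining system `M`. -/
def value (M : DefiningSystem α) : H2 p G := (B2 p G).mkQ ⟨M.cochain, M.cochain_mem_Z2⟩

end DefiningSystem

/-- The `n`-fold Massey product `⟨α₁, …, αₙ⟩`: the set of values of all its defining systems. -/
def masseyProduct {n : ℕ} (α : Fin n → H1 p G) : Set (H2 p G) :=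
  Set.range (DefiningSystem.value (α := α))

/-- The Massey product `⟨α₁, …, αₙ⟩` is defined if it has a defining system. -/
def MasseyDefined {n : ℕ} (α : Fin n → H1 p G) : Prop := Nonempty (DefiningSystem α)

end Cohomology

section Kummer

variable {F : Type*} [Field F] {p : ℕ} [hp : Fact p.Prime] {ζ : F}

/-- A chosen `p`-th root of `a` in the algebraic closure. -/
def pthRoot (p : ℕ) [Fact p.Prime] (a : Fˣ) : AlgebraicClosure F :=
  (IsAlgClosed.exists_pow_nat_eq (algebraMap F (AlgebraicClosure F) a)
    (Nat.Prime.pos (Fact.out : p.Prime))).choose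

lemma pthRoot_pow (a : Fˣ) : pthRoot p a ^ p = algebraMap F (AlgebraicClosure F) a :=
  (IsAlgClosed.exists_pow_nat_eq (algebraMap F (AlgebraicClosure F) a)
    (Nat.Prime.pos (Fact.out : p.Prime))).choose_spec

lemma exists_exponent (hζ : IsPrimitiveRoot ζ p) (a : Fˣ) (σ : Field.absoluteGaloisGroup F) :
    ∃ k : ZMod p, (show Gal(AlgebraicClosure F/F) from σ) (pthRoot p a)
      = algebraMap F (AlgebraicClosure F) ζ ^ k.val * pthRoot p a := by
  have hne : pthRoot p a ≠ 0 := by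
    intro h0
    have := pthRoot_pow (p := p) a
    rw [h0, zero_pow hp.out.ne_zero] at this
    exact a.ne_zero ((map_eq_zero _).1 this.symm)
  have h1 : ((show Gal(AlgebraicClosure F/F) from σ) (pthRoot p a) / pthRoot p a) ^ p = 1 := by
    rw [div_pow, ← map_pow, pthRoot_pow, AlgEquiv.commutes, div_self]
    simp
  obtain ⟨i, hi, he⟩ :=
    (hζ.map_of_injective (algebraMap F (AlgebraicClosure F)).injective).eq_pow_of_pow_eq_one h1
  refine ⟨(i : ZMod p), ?_⟩
  rw [ZMod.val_natCast_of_lt hi, he, div_mul_cancel₀ _ hne]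

/-- The exponent `χ_a(σ) ∈ 𝔽_p` determined by `σ(ᵖ√a) = ζ ^ χ_a(σ) ᵖ√a`. -/
def kummerExponent (hζ : IsPrimitiveRoot ζ p) (a : Fˣ) (σ : Field.absoluteGaloisGroup F) :
    ZMod p := (exists_exponent hζ a σ).choose

lemma kummerExponent_pthRoot (hζ : IsPrimitiveRoot ζ p) (a : Fˣ)
    (σ : Field.absoluteGaloisGroup F) :
    (show Gal(AlgebraicClosure F/F) from σ) (pthRoot p a)
      = algebraMap F (AlgebraicClosure F) ζ ^ (kummerExponent hζ a σ).val * pthRoot p a :=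
  (exists_exponent hζ a σ).choose_spec

/-- The defining relation holds for every `p`-th root of `a`, and determines the exponent. -/
lemma kummerExponent_eq_iff (hζ : IsPrimitiveRoot ζ p) (a : Fˣ)
    (σ : Field.absoluteGaloisGroup F) (x : AlgebraicClosure F)
    (hx : x ^ p = algebraMap F (AlgebraicClosure F) a) (k : ZMod p) :
    kummerExponent hζ a σ = k ↔ (show Gal(AlgebraicClosure F/F) from σ) x
      = algebraMap F (AlgebraicClosure F) ζ ^ k.val * x := by
  have hz := hζ.map_of_injective (algebraMap F (AlgebraicClosure F)).injective
  have hane : algebraMap F (AlgebraicClosure F) a ≠ 0 := by simp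
  have hrne : pthRoot p a ≠ 0 := by
    intro h0
    rw [← pthRoot_pow (p := p) a, h0, zero_pow hp.out.ne_zero] at hane
    exact hane rfl
  have hxne : x ≠ 0 := by
    intro h0
    rw [← hx, h0, zero_pow hp.out.ne_zero] at hane
    exact hane rfl
  have h1 : (x / pthRoot p a) ^ p = 1 := by
    rw [div_pow, hx, pthRoot_pow, div_self hane]
  obtain ⟨i, hi, he⟩ := hz.eq_pow_of_pow_eq_one h1
  have hxe : x = algebraMap F (AlgebraicClosure F) ζ ^ i * pthRoot p a := by
    rw [he, div_mul_cancel₀ _ hrne]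
  have hrel : (show Gal(AlgebraicClosure F/F) from σ) x
      = algebraMap F (AlgebraicClosure F) ζ ^ (kummerExponent hζ a σ).val * x := by
    conv_lhs => rw [hxe]
    rw [map_mul, map_pow, AlgEquiv.commutes, kummerExponent_pthRoot hζ a σ, hxe]
    ring
  constructor
  · rintro rfl
    exact hrel
  · intro h
    rw [hrel] at h
    have := hz.pow_inj (ZMod.val_lt _) (ZMod.val_lt _) (mul_right_cancel₀ hxne h)
    exact ZMod.val_injective p this

lemma kummerExponent_mul (hζ : IsPrimitiveRoot ζ p) (a : Fˣ)
    (σ τ : Field.absoluteGaloisGroup F) :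
    kummerExponent hζ a (σ * τ) = kummerExponent hζ a σ + kummerExponent hζ a τ := by
  have hz := hζ.map_of_injective (algebraMap F (AlgebraicClosure F)).injective
  rw [kummerExponent_eq_iff hζ a (σ * τ) _ (pthRoot_pow a)]
  change (show Gal(AlgebraicClosure F/F) from σ)
    ((show Gal(AlgebraicClosure F/F) from τ) (pthRoot p a)) = _
  rw [kummerExponent_pthRoot hζ a τ, map_mul, map_pow, AlgEquiv.commutes,
    kummerExponent_pthRoot hζ a σ, ← mul_assoc, ← pow_add, ZMod.val_add,
    ← pow_mod_orderOf, ← hz.eq_orderOf, add_comm]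

lemma continuous_kummerExponent (hζ : IsPrimitiveRoot ζ p) (a : Fˣ) :
    Continuous (kummerExponent hζ a) := by
  let φ : Field.absoluteGaloisGroup F →* Multiplicative (ZMod p) :=
    { toFun := fun σ => Multiplicative.ofAdd (kummerExponent hζ a σ)
      map_one' := by
        have := kummerExponent_mul hζ a 1 1
        rw [mul_one] at this
        rw [left_eq_add.1 this, ofAdd_zero]
      map_mul' := fun σ τ => by rw [kummerExponent_mul, ofAdd_add] }
  have hφ : IsOpen (φ.ker : Set (Field.absoluteGaloisGroup F)) := by
    have h := stabilizer_isOpen_of_isIntegral (K := F) (pthRoot p a)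
    have e : (φ.ker : Set (Field.absoluteGaloisGroup F))
        = (MulAction.stabilizer Gal(AlgebraicClosure F/F) (pthRoot p a) :
          Set Gal(AlgebraicClosure F/F)) := by
      ext σ
      change kummerExponent hζ a σ = 0 ↔
        (show Gal(AlgebraicClosure F/F) from σ) (pthRoot p a) = pthRoot p a
      rw [kummerExponent_eq_iff hζ a σ _ (pthRoot_pow a), ZMod.val_zero, pow_zero, one_mul]
    rw [e]
    exact h
  rw [continuous_discrete_rng]
  intro k
  rw [isOpen_iff_mem_nhds]
  intro σ hσ
  have h2 : IsOpen ((fun τ => σ⁻¹ * τ) ⁻¹' (φ.ker : Set (Field.absoluteGaloisGroup F))) :=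
    hφ.preimage (continuous_const_mul _)
  refine Filter.mem_of_superset (h2.mem_nhds (by simp)) ?_
  intro τ hτ
  have hτ' : φ (σ⁻¹ * τ) = 1 := hτ
  rw [map_mul, map_inv, inv_mul_eq_one] at hτ'
  have : kummerExponent hζ a σ = kummerExponent hζ a τ := hτ'
  rw [Set.mem_preimage, Set.mem_singleton_iff] at hσ ⊢
  rw [← this, hσ]

/-- The character `χ_a` as a continuous `1`-cocycle of the absolute Galois group. -/
def kummerCocycle (hζ : IsPrimitiveRoot ζ p) (a : Fˣ) : Z1 p (Field.absoluteGaloisGroup F) :=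
  ⟨⟨kummerExponent hζ a, continuous_kummerExponent hζ a⟩,
    (mem_Z1 _).2 (kummerExponent_mul hζ a)⟩

/-- The Kummer class `χ_a ∈ H¹(G_F, 𝔽_p)` (with respect to `ζ`). -/
def kummerClass (hζ : IsPrimitiveRoot ζ p) (a : Fˣ) : H1 p (Field.absoluteGaloisGroup F) :=
  (B1 p (Field.absoluteGaloisGroup F)).mkQ (kummerCocycle hζ a)

/-- `a` is `p`-rigid: `χ_a ∪ χ_b = 0` implies `b ∈ a ^ i F ^ p` for some `i ≥ 0`. -/
def IsRigidElement (hζ : IsPrimitiveRoot ζ p) (a : Fˣ) : Prop :=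
  ∀ b : Fˣ, cupH (kummerClass hζ a) (kummerClass hζ b) = 0 →
    ∃ (i : ℕ) (c : F), (b : F) = (a : F) ^ i * c ^ p

/-- The field `F` is `p`-rigid: every element of `F` that is not a `p`-th power is `p`-rigid. -/
def IsRigidField (hζ : IsPrimitiveRoot ζ p) : Prop :=
  ∀ a : Fˣ, (¬ ∃ c : F, c ^ p = (a : F)) → IsRigidElement hζ a

end Kummer

end

end MasseyRigid

/-!
Two facts carry the proof.

The first holds over every field `F` containing `ζ`, rigid or not: for each `a`, the constant
sequence `χ_a, …, χ_a` of any length is the sequence of entries next to the diagonal, up to sign, of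
a continuous unipotent representation of `G_F` (`exists_unipotent_kummer`). Indeed `G_F` permutes
the `p ^ k`-th roots of `a` through affine maps `x ↦ θ x + c` of `ℤ / p ^ k`, where `θ` is the
cyclotomic character and `c` lifts `χ_a` (`exists_affine_action`). Hence it acts on the group
algebra `𝔽_p[ℤ / p ^ k] = 𝔽_p[X] / (X ^ (p ^ k))`, where `1 + X` is the generator of the group, by
`X ^ i ↦ (1 + X) ^ c ((1 + X) ^ θ - 1) ^ i`. As `θ ≡ 1` modulo `p` and `p` is odd,
`(1 + X) ^ θ - 1` is congruent to `X` modulo `X ^ 3`, so in the basis of powers of `X` the action is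
unipotent and has the entries `c ≡ χ_a` next to the diagonal (`affineCoeff_self`,
`affineCoeff_succ`). Taking `p ^ k > n` gives matrices of the required size.

The second is the shape of the sequence `α₁, …, αₙ` over a rigid field. If the Massey product is
defined and `n ≥ 3`, then `α_i ∪ α_{i+1} = 0`, and since every character is a Kummer character
(`exists_kummerCocycle_eq`, from Hilbert 90), rigidity makes `α_{i+1}` a multiple of `α_i` whenever
`α_i ≠ 0`. So the sequence splits at its zeros into blocks of multiples of one Kummer character:
`α_i = c_i χ_{r_i}`, with `r` constant along the nonzero scalars (`exists_kummer_scalars`).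

Scaling the entry `(i, j)` by `c_i ⋯ c_{j-1}` turns the representations for the constant sequences
into one for each block, and makes all entries across a zero vanish, so that the result is again
multiplicative (`d1_prod_smul_eq_sum_cup`). A multiplicative matrix including its upper right corner
is a defining system of value zero (`zero_mem_masseyProduct`).
-/

namespace MasseyRigid

/-! ### Affine substitutions in polynomials over `𝔽_p` -/

section AffineSubstitution

open Polynomial

lemma dvd_one_add_pow_sub_one {R : Type*} [CommRing R] (x : R) (n : ℕ) :
    x ∣ (1 + x) ^ n - 1 := by
  simpa using sub_dvd_pow_sub_pow (1 + x) 1 n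

variable {p : ℕ}

/-- The action of the affine map `x ↦ θ x + c` on `𝔽_p[X]`, where `1 + X` plays the role of a
generator of the translations: the `𝔽_p`-linear map with `(1 + X) ^ x ↦ (1 + X) ^ (θ x + c)`. -/
noncomputable def affineSubst (p θ c : ℕ) : (ZMod p)[X] →ₗ[ZMod p] (ZMod p)[X] where
  toFun f := (1 + X) ^ c * f.comp ((1 + X) ^ θ - 1)
  map_add' f g := by rw [add_comp, mul_add]
  map_smul' r f := by rw [smul_comp, mul_smul_comm, RingHom.id_apply]

/-- The matrix of `affineSubst p θ c` in the basis of powers of `X`, its `i`-th row being the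
image of `X ^ i`. -/
noncomputable def affineCoeff (p θ c i j : ℕ) : ZMod p := (affineSubst p θ c (X ^ i)).coeff j

lemma affineSubst_X_pow (θ c i : ℕ) :
    affineSubst p θ c (X ^ i) = (1 + X) ^ c * ((1 + X) ^ θ - 1) ^ i := by
  simp [affineSubst]

lemma affineSubst_affineSubst (θ c θ' c' : ℕ) (f : (ZMod p)[X]) :
    affineSubst p θ c (affineSubst p θ' c' f) = affineSubst p (θ * θ') (c + θ * c') f := by
  simp only [affineSubst, LinearMap.coe_mk, AddHom.coe_mk, mul_comp, comp_assoc, pow_comp,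
    sub_comp, add_comp, X_comp, one_comp, add_sub_cancel, ← pow_mul, pow_add, mul_assoc]

lemma affineCoeff_of_lt {θ c i j : ℕ} (h : j < i) : affineCoeff p θ c i j = 0 := by
  have h1 : (X : (ZMod p)[X]) ∣ (1 + X) ^ θ - 1 := dvd_one_add_pow_sub_one _ _
  rw [affineCoeff, affineSubst_X_pow]
  exact X_pow_dvd_iff.1 ((pow_dvd_pow_of_dvd h1 i).mul_left _) j h

lemma coeff_affineSubst (θ c l : ℕ) (f : (ZMod p)[X]) :
    (affineSubst p θ c f).coeff l
      = ∑ j ∈ Finset.range (l + 1), f.coeff j * affineCoeff p θ c j l := by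
  induction f using Polynomial.induction_on' with
  | add f g hf hg => simp only [map_add, coeff_add, hf, hg, add_mul, Finset.sum_add_distrib]
  | monomial m r =>
    rw [← C_mul_X_pow_eq_monomial, ← smul_eq_C_mul, map_smul, coeff_smul, smul_eq_mul]
    simp only [coeff_smul, coeff_X_pow, smul_eq_mul, mul_ite, mul_one, mul_zero, ite_mul,
      zero_mul, Finset.sum_ite_eq', Finset.mem_range]
    split_ifs with h
    · rfl
    · change r * affineCoeff p θ c m l = 0
      rw [affineCoeff_of_lt (by omega), mul_zero]

/-- Substitutions act on the left, so that their matrices multiply in the reverse order. -/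
lemma affineCoeff_comp (θ c θ' c' i l : ℕ) :
    affineCoeff p (θ * θ') (c + θ * c') i l
      = ∑ j ∈ Finset.Icc i l, affineCoeff p θ' c' i j * affineCoeff p θ c j l := by
  rw [affineCoeff, ← affineSubst_affineSubst, coeff_affineSubst]
  refine (Finset.sum_subset ?_ ?_).symm
  · intro j
    simp only [Finset.mem_Icc, Finset.mem_range]
    omega
  · intro j h1 h2
    simp only [Finset.mem_Icc, Finset.mem_range] at h1 h2
    change affineCoeff p θ' c' i j * _ = 0
    rw [affineCoeff_of_lt (by omega), zero_mul]

variable [hp : Fact p.Prime]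

/-- As `(1 + X) ^ (p ^ k) ≡ 1` modulo `X ^ (p ^ k)`, the coefficients below `p ^ k` depend only on
the affine map modulo `p ^ k`. -/
lemma affineCoeff_congr {k θ c θ' c' : ℕ} (hθ : θ ≡ θ' [MOD p ^ k]) (hc : c ≡ c' [MOD p ^ k])
    (i : ℕ) {j : ℕ} (hj : j < p ^ k) : affineCoeff p θ c i j = affineCoeff p θ' c' i j := by
  have h1 : (Ideal.Quotient.mk (Ideal.span {(X : (ZMod p)[X]) ^ p ^ k}) (1 + X)) ^ p ^ k = 1 := by
    rw [← map_pow, add_pow_char_pow, one_pow, map_add, map_one, add_eq_left,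
      Ideal.Quotient.eq_zero_iff_mem]
    exact Ideal.mem_span_singleton_self _
  have h2 : affineSubst p θ c (X ^ i) - affineSubst p θ' c' (X ^ i)
      ∈ Ideal.span {(X : (ZMod p)[X]) ^ p ^ k} := by
    rw [← Ideal.Quotient.eq, affineSubst_X_pow, affineSubst_X_pow]
    simp only [map_mul, map_pow, map_sub, map_one]
    rw [pow_eq_pow_of_modEq hθ h1, pow_eq_pow_of_modEq hc h1]
  have h3 := X_pow_dvd_iff.1 (Ideal.mem_span_singleton.1 h2) j hj
  rw [coeff_sub, sub_eq_zero] at h3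
  exact h3

/-- For `θ = 1 + p t`, the element `(1 + X) ^ θ - 1 = (1 + X) (1 + X ^ p) ^ t - 1` agrees with `X`
to order `p ≥ 3`. -/
lemma one_add_X_pow_sub_one_eq (hp2 : Odd p) {θ : ℕ} (hθ : θ ≡ 1 [MOD p]) :
    ∃ R : (ZMod p)[X], (1 + X : (ZMod p)[X]) ^ θ - 1 = X * (1 + X ^ 2 * R) := by
  have h3 : 3 ≤ p := by
    have := hp.out.two_le
    rcases hp2 with ⟨m, hm⟩
    omega
  have hd : (X : (ZMod p)[X]) ^ 3 ∣ (1 + X) ^ θ - (1 + X) := by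
    have h1 : ((Ideal.Quotient.mk (Ideal.span {(X : (ZMod p)[X]) ^ p})) (1 + X)) ^ p = 1 := by
      rw [← map_pow, add_pow_char, one_pow, map_add, map_one, add_eq_left,
        Ideal.Quotient.eq_zero_iff_mem]
      exact Ideal.mem_span_singleton_self _
    refine (pow_dvd_pow X h3).trans ?_
    rw [← Ideal.mem_span_singleton, ← Ideal.Quotient.eq, map_pow, pow_eq_pow_of_modEq hθ h1,
      pow_one]
  obtain ⟨R, hR⟩ := hd
  exact ⟨R, by linear_combination hR⟩

/-- The shape of the rows of the matrix near the diagonal. -/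
lemma affineSubst_X_pow_eq (hp2 : Odd p) {θ : ℕ} (hθ : θ ≡ 1 [MOD p]) (c i : ℕ) :
    ∃ S : (ZMod p)[X],
      affineSubst p θ c (X ^ i) = (1 + C (c : ZMod p) * X + S * X ^ 2) * X ^ i := by
  obtain ⟨R, hR⟩ := one_add_X_pow_sub_one_eq hp2 hθ
  obtain ⟨S, hS⟩ : (X : (ZMod p)[X]) ^ 2 ∣ (1 + X ^ 2 * R) ^ i - 1 :=
    (dvd_mul_right _ R).trans
      (dvd_one_add_pow_sub_one _ _)
  obtain ⟨T, hT⟩ : (X : (ZMod p)[X]) ^ 2 ∣ (1 + X) ^ c - (1 + C (c : ZMod p) * X) := by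
    refine X_pow_dvd_iff.2 fun d hd => ?_
    rw [coeff_sub, coeff_one_add_X_pow, coeff_add, coeff_C_mul, coeff_X, coeff_one]
    interval_cases d <;> simp
  refine ⟨T + (1 + X) ^ c * S, ?_⟩
  rw [affineSubst_X_pow, hR, mul_pow]
  linear_combination (1 + X : (ZMod p)[X]) ^ c * X ^ i * hS + X ^ i * hT

lemma affineCoeff_self (hp2 : Odd p) {θ : ℕ} (hθ : θ ≡ 1 [MOD p]) (c i : ℕ) :
    affineCoeff p θ c i i = 1 := by
  obtain ⟨S, hS⟩ := affineSubst_X_pow_eq hp2 hθ c i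
  rw [affineCoeff, hS, coeff_mul_X_pow', if_pos le_rfl, Nat.sub_self]
  simp

lemma affineCoeff_succ (hp2 : Odd p) {θ : ℕ} (hθ : θ ≡ 1 [MOD p]) (c i : ℕ) :
    affineCoeff p θ c i (i + 1) = c := by
  obtain ⟨S, hS⟩ := affineSubst_X_pow_eq hp2 hθ c i
  rw [affineCoeff, hS, coeff_mul_X_pow', if_pos (Nat.le_succ i), Nat.add_sub_cancel_left]
  simp [coeff_mul_X_pow', coeff_one]

end AffineSubstitution

/-! ### Characters of the absolute Galois group are Kummer characters -/

section Galois

variable {F : Type*} [Field F]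

/-- A function on the absolute Galois group is continuous if its value at `σ` is determined by the
images under `σ` of two fixed elements of the algebraic closure. -/
lemma continuous_of_apply_eq {T : Type*} [TopologicalSpace T] [DiscreteTopology T]
    (f : Gal(AlgebraicClosure F/F) → T) (x y : AlgebraicClosure F)
    (h : ∀ σ τ : Gal(AlgebraicClosure F/F), σ x = τ x → σ y = τ y → f σ = f τ) :
    Continuous f := by
  rw [continuous_discrete_rng]
  intro k
  rw [isOpen_iff_mem_nhds]
  intro σ hσ
  have hU : IsOpen ((MulAction.stabilizer Gal(AlgebraicClosure F/F) x :
      Set Gal(AlgebraicClosure F/F)) ∩ MulAction.stabilizer Gal(AlgebraicClosure F/F) y) :=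
    (stabilizer_isOpen_of_isIntegral x).inter (stabilizer_isOpen_of_isIntegral y)
  refine Filter.mem_of_superset ((hU.preimage (continuous_const_mul σ⁻¹)).mem_nhds ?_) ?_
  · rw [Set.mem_preimage, inv_mul_cancel]
    exact ⟨one_mem _, one_mem _⟩
  rintro τ ⟨h3, h4⟩
  rw [SetLike.mem_coe, MulAction.mem_stabilizer_iff, mul_smul, inv_smul_eq_iff] at h3 h4
  rw [Set.mem_preimage, Set.mem_singleton_iff] at hσ ⊢
  rw [← hσ]
  exact h _ _ h3 h4

/-- An element of the algebraic closure fixed by all automorphisms is purely inseparable. -/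
lemma exists_pow_eq_algebraMap_of_fixed (q : ℕ) [ExpChar F q] (b : AlgebraicClosure F)
    (hb : ∀ σ : Gal(AlgebraicClosure F/F), σ b = b) :
    ∃ (m : ℕ) (a : F), algebraMap F (AlgebraicClosure F) a = b ^ q ^ m := by
  classical
  have h : b ∈ perfectClosure F (AlgebraicClosure F) := by
    rw [mem_perfectClosure_iff_natSepDegree_eq_one,
      Polynomial.natSepDegree_eq_of_isAlgClosed (AlgebraicClosure F), Finset.card_eq_one]
    have hi : IsIntegral F b := Algebra.IsIntegral.isIntegral b
    refine ⟨b, ?_⟩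
    ext y
    rw [Multiset.mem_toFinset, Polynomial.mem_aroots, Finset.mem_singleton]
    constructor
    · rintro ⟨-, hy⟩
      obtain ⟨σ, hσ⟩ := minpoly.exists_algEquiv_of_root hi.isAlgebraic hy
      exact σ.injective (hσ.trans (hb σ).symm)
    · rintro rfl
      exact ⟨minpoly.ne_zero hi, minpoly.aeval F y⟩
  obtain ⟨m, a, ha⟩ := (mem_perfectClosure_iff_pow_mem q).1 h
  exact ⟨m, a, ha⟩

variable {p : ℕ} [hp : Fact p.Prime] {ζ : F}

/-- Kummer theory, first half: a continuous character into `μ_p` is the coboundary of a unit `y` of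
the algebraic closure, by Hilbert 90 over a finite normal extension that it factors through. -/
lemma exists_apply_eq_pow_mul (hζ : IsPrimitiveRoot ζ p)
    {f : Gal(AlgebraicClosure F/F) → ZMod p} (hf : ∀ σ τ, f (σ * τ) = f σ + f τ)
    (hfc : Continuous f) :
    ∃ y : AlgebraicClosure F, y ≠ 0 ∧ ∀ σ : Gal(AlgebraicClosure F/F),
      σ y = algebraMap F (AlgebraicClosure F) ζ ^ (f σ).val * y := by
  have hf1 : f 1 = 0 := by
    have := hf 1 1
    rwa [mul_one, left_eq_add] at this
  have hker : {σ : Gal(AlgebraicClosure F/F) | f σ = 0} ∈ nhds 1 := by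
    exact ((isOpen_discrete {0}).preimage hfc).mem_nhds hf1
  obtain ⟨E, hE, hEn, hEs⟩ := (krullTopology_mem_nhds_one_iff_of_normal F _ _).1 hker
  have hsurj : Function.Surjective
      (AlgEquiv.restrictNormalHom (F := F) (K₁ := AlgebraicClosure F) E) :=
    AlgEquiv.restrictNormalHom_surjective (AlgebraicClosure F)
  have hfac : ∀ σ τ : Gal(AlgebraicClosure F/F), AlgEquiv.restrictNormalHom E σ
      = AlgEquiv.restrictNormalHom E τ → f σ = f τ := by
    intro σ τ h
    have h1 : σ⁻¹ * τ ∈ (AlgEquiv.restrictNormalHom (F := F) (K₁ := AlgebraicClosure F) E).ker := by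
      rw [MonoidHom.mem_ker, map_mul, map_inv, h, inv_mul_cancel]
    rw [IntermediateField.restrictNormalHom_ker] at h1
    have h2 : f (σ⁻¹ * τ) = 0 := hEs h1
    have h3 := hf σ (σ⁻¹ * τ)
    rw [mul_inv_cancel_left, h2, add_zero] at h3
    exact h3.symm
  let s : Gal(E/F) → Gal(AlgebraicClosure F/F) := Function.surjInv hsurj
  have hs : ∀ σ, AlgEquiv.restrictNormalHom E (s σ) = σ := Function.surjInv_eq hsurj
  let z : Eˣ := Units.mk0 (algebraMap F E ζ)
    (by simpa using hζ.ne_zero hp.out.ne_zero)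
  have hz : z ^ p = 1 := by
    ext
    simp [z, ← map_pow, hζ.pow_eq_one]
  have hcoc : groupCohomology.IsMulCocycle₁ (fun σ : Gal(E/F) => z ^ (f (s σ)).val) := by
    intro σ τ
    have h1 : σ • z ^ (f (s τ)).val = z ^ (f (s τ)).val := by
      ext
      simp [z, AlgEquiv.smul_units_def]
    have h2 : f (s (σ * τ)) = f (s τ) + f (s σ) := by
      rw [add_comm, ← hf]
      exact hfac _ _ (by rw [map_mul, hs, hs, hs])
    beta_reduce
    rw [h1, h2, ← pow_add]
    refine pow_eq_pow_of_modEq ?_ hz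
    rw [ZMod.val_add]
    exact Nat.mod_modEq _ _
  obtain ⟨y, hy⟩ := groupCohomology.isMulCoboundary₁_of_isMulCocycle₁_of_aut_to_units _ hcoc
  refine ⟨((y : E) : AlgebraicClosure F), by simp, fun σ => ?_⟩
  have h1 := hy (AlgEquiv.restrictNormalHom E σ)
  beta_reduce at h1
  rw [div_eq_iff_eq_mul, hfac _ σ (hs _)] at h1
  have h2 := congrArg (fun u : Eˣ => ((u : E) : AlgebraicClosure F)) h1
  simp only [AlgEquiv.smul_units_def, Units.coe_map, Units.val_mul, Units.val_pow_eq_pow_val, z,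
    Units.val_mk0] at h2
  refine Eq.trans ?_ h2
  exact (AlgEquiv.restrictNormal_commutes σ E (y : E)).symm

/-- Kummer theory: every continuous character of the absolute Galois group with values in `𝔽_p` is
a Kummer character. -/
theorem exists_kummerCocycle_eq (hζ : IsPrimitiveRoot ζ p)
    (f : Z1 p (Field.absoluteGaloisGroup F)) : ∃ b : Fˣ, kummerCocycle hζ b = f := by
  obtain ⟨y, hy0, hy⟩ := exists_apply_eq_pow_mul hζ ((mem_Z1 f.1).1 f.2) f.1.continuous
  have hz := hζ.map_of_injective (algebraMap F (AlgebraicClosure F)).injective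
  obtain ⟨q, hq⟩ := ExpChar.exists F
  have hfix : ∀ σ : Gal(AlgebraicClosure F/F), σ (y ^ p) = y ^ p := by
    intro σ
    rw [map_pow, hy, mul_pow, ← pow_mul, mul_comm _ p, pow_mul, hz.pow_eq_one, one_pow, one_mul]
  obtain ⟨m, a, ha⟩ := exists_pow_eq_algebraMap_of_fixed q _ hfix
  -- The characteristic exponent `q` differs from `p`, so `q ^ m` is invertible modulo `p`.
  have hqp : q.Coprime p := by
    have hpF : (p : F) ≠ 0 := by
      have : NeZero p := ⟨hp.out.ne_zero⟩
      exact (hζ.neZero').out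
    cases hq with
    | zero => exact Nat.coprime_one_left p
    | prime hq' =>
      refine (Nat.coprime_primes hq' hp.out).2 ?_
      rintro rfl
      exact hpF (CharP.cast_eq_zero F q)
  obtain ⟨r, hr⟩ : ∃ r, q ^ m * r ≡ 1 [MOD p] := by
    obtain ⟨r, -, hr⟩ := Nat.exists_mul_mod_eq_one_of_coprime (hqp.pow_left m) hp.out.one_lt
    exact ⟨r, by rw [Nat.ModEq, hr, Nat.mod_eq_of_lt hp.out.one_lt]⟩
  have hne : a ≠ 0 := by
    rintro rfl
    rw [map_zero] at ha
    exact pow_ne_zero _ (pow_ne_zero _ hy0) ha.symm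
  refine ⟨Units.mk0 a hne ^ r, ?_⟩
  ext σ
  refine (kummerExponent_eq_iff hζ _ σ (y ^ (q ^ m * r)) ?_ (f.1 σ)).2 ?_
  · rw [Units.val_pow_eq_pow_val, Units.val_mk0, map_pow, ha]
    ring
  · rw [map_pow, show (show Gal(AlgebraicClosure F/F) from σ) y = _ from hy σ, mul_pow, ← pow_mul,
      mul_comm (f.1 σ).val, pow_mul, pow_eq_pow_of_modEq hr hz.pow_eq_one, pow_one]

end Galois

/-! ### Unipotent representations attached to a Kummer character -/

section Representation

variable {F : Type*} [Field F] {p : ℕ} [hp : Fact p.Prime] {ζ : F}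

/-- The Galois group acts on the `p ^ (k + 1)`-th roots of `a` through affine maps
`x ↦ θ x + c`, where `θ` is the cyclotomic character modulo `p ^ (k + 1)` and `c` lifts the Kummer
character of `a`. The exponents are represented by natural numbers; modulo `p ^ (k + 1)`, those of
`σ` depend only on the images under `σ` of a root of unity `ω` and of a root `y` of `a`. -/
lemma exists_affine_action (hζ : IsPrimitiveRoot ζ p) (a : Fˣ) (k : ℕ) :
    ∃ (ω y : AlgebraicClosure F) (θ c : Gal(AlgebraicClosure F/F) → ℕ),
      (∀ σ τ, θ (σ * τ) ≡ θ σ * θ τ [MOD p ^ (k + 1)]) ∧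
      (∀ σ τ, c (σ * τ) ≡ c σ + θ σ * c τ [MOD p ^ (k + 1)]) ∧
      (∀ σ, θ σ ≡ 1 [MOD p]) ∧
      (∀ σ, (c σ : ZMod p) = kummerExponent hζ a σ) ∧
      (∀ σ τ, σ ω = τ ω → θ σ ≡ θ τ [MOD p ^ (k + 1)]) ∧
      (∀ σ τ, σ y = τ y → c σ ≡ c τ [MOD p ^ (k + 1)]) := by
  have hz := hζ.map_of_injective (algebraMap F (AlgebraicClosure F)).injective
  obtain ⟨ω, hω⟩ := IsAlgClosed.exists_pow_nat_eq (algebraMap F (AlgebraicClosure F) ζ)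
    (pow_pos hp.out.pos k)
  obtain ⟨y, hy⟩ := IsAlgClosed.exists_pow_nat_eq (algebraMap F (AlgebraicClosure F) a)
    (pow_pos hp.out.pos (k + 1))
  have hω1 : ω ^ p ^ (k + 1) = 1 := by rw [pow_succ, pow_mul, hω, hz.pow_eq_one]
  have hωp : IsPrimitiveRoot ω (p ^ (k + 1)) := by
    rw [IsPrimitiveRoot.iff_orderOf]
    refine orderOf_eq_prime_pow ?_ hω1
    rw [hω]
    exact hz.ne_one hp.out.one_lt
  have hω0 : ω ≠ 0 := hωp.ne_zero (pow_ne_zero _ hp.out.ne_zero)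
  have hy0 : y ≠ 0 := by
    rintro rfl
    rw [zero_pow (pow_ne_zero _ hp.out.ne_zero)] at hy
    exact a.ne_zero ((map_eq_zero _).1 hy.symm)
  have hmod : ∀ {m m' : ℕ}, ω ^ m = ω ^ m' → m ≡ m' [MOD p ^ (k + 1)] := by
    intro m m' h
    rw [hωp.eq_orderOf]
    exact (isOfFinOrder_iff_pow_eq_one.2 ⟨_, pow_pos hp.out.pos _, hω1⟩).pow_eq_pow_iff_modEq.1 h
  have hθ : ∀ σ : Gal(AlgebraicClosure F/F), ∃ t : ℕ, σ ω = ω ^ t := by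
    intro σ
    obtain ⟨t, -, ht⟩ := hωp.eq_pow_of_pow_eq_one (ξ := σ ω) (by rw [← map_pow, hω1, map_one])
    exact ⟨t, ht.symm⟩
  have hc : ∀ σ : Gal(AlgebraicClosure F/F), ∃ t : ℕ, σ y = ω ^ t * y := by
    intro σ
    obtain ⟨t, -, ht⟩ := hωp.eq_pow_of_pow_eq_one (ξ := σ y / y)
      (by rw [div_pow, ← map_pow, hy, AlgEquiv.commutes, div_self (by simp)])
    exact ⟨t, by rw [ht, div_mul_cancel₀ _ hy0]⟩
  choose θ hθ using hθ
  choose c hc using hc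
  refine ⟨ω, y, θ, c, fun σ τ => hmod ?_, fun σ τ => hmod ?_, fun σ => ?_, fun σ => ?_,
    fun σ τ h => hmod ?_, fun σ τ h => hmod ?_⟩
  · rw [← hθ, AlgEquiv.mul_apply, hθ τ, map_pow, hθ σ, ← pow_mul]
  · refine mul_right_cancel₀ hy0 ?_
    rw [← hc, AlgEquiv.mul_apply, hc τ, map_mul, map_pow, hθ σ, hc σ, ← pow_mul, pow_add]
    ring
  · rw [hz.eq_orderOf]
    refine (isOfFinOrder_iff_pow_eq_one.2
      ⟨p, hp.out.pos, hz.pow_eq_one⟩).pow_eq_pow_iff_modEq.1 ?_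
    rw [← hω, ← pow_mul, mul_comm, pow_mul, ← hθ, ← map_pow, hω, AlgEquiv.commutes, pow_one]
  · refine ((kummerExponent_eq_iff hζ a σ (y ^ p ^ k) ?_ _).2 ?_).symm
    · rw [← pow_mul, ← pow_succ, hy]
    · rw [ZMod.val_natCast, map_pow]
      change (σ y) ^ p ^ k = _
      rw [hc, mul_pow, ← pow_mul, mul_comm (c σ), pow_mul, hω]
      congr 1
      exact pow_eq_pow_of_modEq (Nat.mod_modEq _ _).symm hz.pow_eq_one
  · rw [← hθ, ← hθ, h]
  · refine mul_right_cancel₀ hy0 ?_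
    rw [← hc, ← hc, h]

/-- For every `a`, the constant sequence `χ_a, …, χ_a` of any length comes from a continuous
unipotent upper triangular representation of the absolute Galois group. It is written here as an
infinite matrix whose upper left block of size `n + 1` is multiplicative. -/
theorem exists_unipotent_kummer (hp2 : Odd p) (hζ : IsPrimitiveRoot ζ p) (a : Fˣ) (n : ℕ) :
    ∃ U : ℕ → ℕ → C1 p (Field.absoluteGaloisGroup F),
      (∀ i ≤ n, ∀ σ, U i i σ = 1) ∧
      (∀ i < n, ∀ σ, U i (i + 1) σ = -kummerExponent hζ a σ) ∧
      ∀ i j, j ≤ n → ∀ σ τ, U i j (σ * τ) = ∑ l ∈ Finset.Icc i j, U i l σ * U l j τ := by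
  obtain ⟨ω, y, θ, c, hθ, hc, hθ1, hca, hθω, hcy⟩ := exists_affine_action hζ a n
  have hn : ∀ {j}, j ≤ n → j < p ^ (n + 1) := fun h =>
    (Nat.lt_succ_of_le h).trans (Nat.lt_pow_self hp.out.one_lt)
  have hcont : ∀ i j, j ≤ n → Continuous fun σ : Gal(AlgebraicClosure F/F) =>
      affineCoeff p (θ σ) (c σ) i j := fun i j hj =>
    continuous_of_apply_eq _ ω y fun σ τ h1 h2 =>
      affineCoeff_congr (hθω σ τ h1) (hcy σ τ h2) i (hn hj)
  -- The matrices multiply in the reverse order, so they are evaluated at inverses.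
  let U : ℕ → ℕ → C1 p (Field.absoluteGaloisGroup F) := fun i j =>
    if hj : j ≤ n then ⟨_, (hcont i j hj).comp continuous_inv⟩ else 0
  have hU : ∀ i j, j ≤ n → ∀ σ : Gal(AlgebraicClosure F/F),
      U i j σ = affineCoeff p (θ σ⁻¹) (c σ⁻¹) i j := by
    intro i j hj σ
    simp only [U, dif_pos hj]
    rfl
  refine ⟨U, fun i hi σ => ?_, fun i hi σ => ?_, fun i j hj σ τ => ?_⟩
  · exact (hU i i hi σ).trans (affineCoeff_self hp2 (hθ1 _) _ _)
  · refine (hU i (i + 1) hi σ).trans ((affineCoeff_succ hp2 (hθ1 _) _ _).trans ?_)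
    rw [hca, eq_neg_iff_add_eq_zero]
    have h1 := kummerExponent_mul hζ a σ⁻¹ σ
    have h2 := kummerExponent_mul hζ a 1 1
    rw [mul_one, left_eq_add] at h2
    rw [inv_mul_cancel, h2] at h1
    exact h1.symm
  · have key : ∀ σ τ : Gal(AlgebraicClosure F/F), affineCoeff p (θ (σ * τ)⁻¹) (c (σ * τ)⁻¹) i j
        = ∑ l ∈ Finset.Icc i j,
          affineCoeff p (θ σ⁻¹) (c σ⁻¹) i l * affineCoeff p (θ τ⁻¹) (c τ⁻¹) l j := by
      intro σ τ
      rw [← affineCoeff_comp, mul_inv_rev]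
      exact affineCoeff_congr (hθ _ _) (hc _ _) i (hn hj)
    refine ((hU i j hj _).trans (key σ τ)).trans (Finset.sum_congr rfl fun l hl => ?_).symm
    exact congrArg₂ _ (hU i l ((Finset.mem_Icc.1 hl).2.trans hj) σ) (hU l j hj τ)

end Representation

/-! ### Sequences of characters over a rigid field -/

section Rigid

variable {F : Type*} [Field F] {p : ℕ} [hp : Fact p.Prime] {ζ : F}

lemma kummerCocycle_eq_zero_of_pow_eq (hζ : IsPrimitiveRoot ζ p) {a : Fˣ} {c : F}
    (h : c ^ p = a) : kummerCocycle hζ a = 0 := by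
  ext σ
  refine (kummerExponent_eq_iff hζ a σ (algebraMap F _ c) (by rw [← map_pow, h]) 0).2 ?_
  rw [ZMod.val_zero, pow_zero, one_mul]
  exact AlgEquiv.commutes (show Gal(AlgebraicClosure F/F) from σ) c

lemma kummerCocycle_eq_smul_of_eq_pow_mul (hζ : IsPrimitiveRoot ζ p) {a b : Fˣ} {c : F} {i : ℕ}
    (h : (b : F) = (a : F) ^ i * c ^ p) :
    kummerCocycle hζ b = (i : ZMod p) • kummerCocycle hζ a := by
  have hz := hζ.map_of_injective (algebraMap F (AlgebraicClosure F)).injective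
  ext σ
  refine (kummerExponent_eq_iff hζ b σ (pthRoot p a ^ i * algebraMap F _ c) ?_
    ((i : ZMod p) * kummerExponent hζ a σ)).2 ?_
  · rw [mul_pow, ← pow_mul, mul_comm i, pow_mul, pthRoot_pow, h, map_mul, map_pow, map_pow]
  · rw [map_mul, map_pow, kummerExponent_pthRoot, AlgEquiv.commutes, mul_pow, ← pow_mul, mul_assoc]
    congr 1
    refine pow_eq_pow_of_modEq ?_ hz.pow_eq_one
    rw [← ZMod.natCast_eq_natCast_iff]
    push_cast
    rw [ZMod.natCast_zmod_val, ZMod.natCast_zmod_val, mul_comm]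

/-- Rigidity in terms of characters: the annihilator of a nonzero character under the cup product
is contained in the line spanned by this character. -/
lemma exists_smul_of_cupH_eq_zero {hζ : IsPrimitiveRoot ζ p} (hF : IsRigidField hζ) {a : Fˣ}
    (ha : kummerCocycle hζ a ≠ 0) (β : Z1 p (Field.absoluteGaloisGroup F))
    (h : cupH (kummerClass hζ a) ((B1 p (Field.absoluteGaloisGroup F)).mkQ β) = 0) :
    ∃ c : ZMod p, β = c • kummerCocycle hζ a := by
  obtain ⟨b, rfl⟩ := exists_kummerCocycle_eq hζ β
  obtain ⟨i, c, hc⟩ := hF a (fun ⟨c, hc⟩ => ha (kummerCocycle_eq_zero_of_pow_eq hζ hc)) b h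
  exact ⟨i, kummerCocycle_eq_smul_of_eq_pow_mul hζ hc⟩

lemma cupH_mkQ_eq_zero_of_smul {G : Type*} [Group G] [TopologicalSpace G] [IsTopologicalGroup G]
    {β γ : Z1 p G} {c : ZMod p} (hc : c ≠ 0) {f : C1 p G}
    (hf : d1 p G f = cup (c • β).1 γ.1) :
    cupH ((B1 p G).mkQ β) ((B1 p G).mkQ γ) = 0 := by
  change (B2 p G).mkQ _ = 0
  rw [Submodule.mkQ_apply, Submodule.Quotient.mk_eq_zero]
  refine ⟨c⁻¹ • f, ?_⟩
  rw [map_smul, hf]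
  ext x
  change c⁻¹ * (c * β.1 x.1 * γ.1 x.2) = β.1 x.1 * γ.1 x.2
  rw [mul_assoc, inv_mul_cancel_left₀ hc]

/-- Over a rigid field, a sequence of characters with consecutive cup products zero splits at its
zeros into blocks of multiples of one Kummer character. -/
theorem exists_kummer_scalars {hζ : IsPrimitiveRoot ζ p} (hF : IsRigidField hζ)
    (β : ℕ → Z1 p (Field.absoluteGaloisGroup F))
    (hβ : ∀ i, ∃ f, d1 p _ f = cup (β i).1 (β (i + 1)).1) :
    ∃ (r : ℕ → Fˣ) (c : ℕ → ZMod p), (∀ i, β i = c i • kummerCocycle hζ (r i)) ∧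
      ∀ i, c i ≠ 0 → c (i + 1) ≠ 0 → r (i + 1) = r i := by
  classical
  -- The base element `r i` is kept as long as the next character is a multiple of `χ_{r i}`.
  choose e he using exists_kummerCocycle_eq hζ
  let r : ℕ → Fˣ := fun i => Nat.rec (e (β 0))
    (fun j b => if ∃ c : ZMod p, β (j + 1) = c • kummerCocycle hζ b then b else e (β (j + 1))) i
  have hr : ∀ j, r (j + 1) = if ∃ c : ZMod p, β (j + 1) = c • kummerCocycle hζ (r j) then r j
      else e (β (j + 1)) := fun j => rfl
  have hc : ∀ i, ∃ c : ZMod p, β i = c • kummerCocycle hζ (r i) ∧ (β i = 0 → c = 0) := by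
    intro i
    have h1 : ∃ c : ZMod p, β i = c • kummerCocycle hζ (r i) := by
      cases i with
      | zero => exact ⟨1, by rw [one_smul]; exact (he _).symm⟩
      | succ j =>
        rw [hr]
        split_ifs with h
        · exact h
        · exact ⟨1, by rw [one_smul, he]⟩
    by_cases h0 : β i = 0
    · exact ⟨0, by rw [h0, zero_smul], fun _ => rfl⟩
    · obtain ⟨c, hc⟩ := h1
      exact ⟨c, hc, fun h => absurd h h0⟩
  choose c hc hc0 using hc
  refine ⟨r, c, hc, fun i hi _ => ?_⟩
  by_cases h0 : kummerCocycle hζ (r i) = 0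
  · exact absurd (hc0 i (by rw [hc i, h0, smul_zero])) hi
  · obtain ⟨f, hf⟩ := hβ i
    rw [hc i] at hf
    rw [hr, if_pos (exists_smul_of_cupH_eq_zero hF h0 _ (cupH_mkQ_eq_zero_of_smul hi hf))]

end Rigid

/-! ### Defining systems from unipotent matrices -/

section Massey

variable {p : ℕ} {G : Type*} [Group G] [TopologicalSpace G] [IsTopologicalGroup G]

lemma d1_apply (f : C1 p G) (g h : G) : d1 p G f (g, h) = f h - f (g * h) + f g := rfl

lemma d1_eq_sum_cup_iff {ι : Type*} (f : C1 p G) (s : Finset ι) (a b : ι → C1 p G) :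
    d1 p G f = ∑ l ∈ s, cup (a l) (b l)
      ↔ ∀ g h, f (g * h) = f g + f h - ∑ l ∈ s, a l g * b l h := by
  rw [ContinuousMap.ext_iff, Prod.forall]
  refine forall₂_congr fun g h => ?_
  rw [d1_apply, ContinuousMap.sum_apply]
  change _ = ∑ l ∈ s, a l g * b l h ↔ _
  constructor <;> intro H <;> linear_combination -H

/-- A unipotent upper triangular matrix `(u i j)` that is multiplicative gives, after a change of
sign, entries of a defining system. Entries that come from different matrices may be glued, and
scaled by `c i ⋯ c (j - 1)`, provided that the matrix changes only across vanishing scalars. -/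
lemma d1_prod_smul_eq_sum_cup {T : Type*} {n : ℕ} (U : T → ℕ → ℕ → C1 p G)
    (h1 : ∀ t, ∀ i ≤ n, ∀ g, U t i i g = 1)
    (hmul : ∀ t i j, j ≤ n → ∀ g h,
      U t i j (g * h) = ∑ l ∈ Finset.Icc i j, U t i l g * U t l j h)
    (r : ℕ → T) (c : ℕ → ZMod p) (hr : ∀ i, c i ≠ 0 → c (i + 1) ≠ 0 → r (i + 1) = r i)
    {i j : ℕ} (hij : i < j) (hj : j ≤ n) :
    d1 p G (-(∏ l ∈ Finset.Ico i j, c l) • U (r i) i j)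
      = ∑ l ∈ Finset.Ioo i j, cup (-(∏ k ∈ Finset.Ico i l, c k) • U (r i) i l)
          (-(∏ k ∈ Finset.Ico l j, c k) • U (r l) l j) := by
  rw [d1_eq_sum_cup_iff]
  intro g h
  have hsplit : ∀ f : ℕ → ZMod p,
      ∑ l ∈ Finset.Icc i j, f l = f i + f j + ∑ l ∈ Finset.Ioo i j, f l := by
    intro f
    rw [← Finset.Ico_insert_right hij.le, Finset.sum_insert (by simp),
      ← Finset.Ioo_insert_left hij, Finset.sum_insert (by simp)]
    ring
  have hterm : ∀ l ∈ Finset.Ioo i j,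
      (-(∏ k ∈ Finset.Ico i l, c k) • U (r i) i l) g
        * (-(∏ k ∈ Finset.Ico l j, c k) • U (r l) l j) h
      = (∏ k ∈ Finset.Ico i j, c k) * (U (r i) i l g * U (r i) l j h) := by
    intro l hl
    rw [Finset.mem_Ioo] at hl
    rw [← Finset.prod_Ico_consecutive c hl.1.le hl.2.le]
    simp only [ContinuousMap.smul_apply, smul_eq_mul]
    -- Either all three entries come from the same matrix, or both sides vanish.
    by_cases h0 : ∀ k ∈ Finset.Ico i j, c k ≠ 0
    · have hrl : r l = r i := by
        have : ∀ k, i ≤ k → k < j → r k = r i := by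
          intro k hk
          induction k, hk using Nat.le_induction with
          | base => exact fun _ => rfl
          | succ k hk ih =>
            intro hkj
            rw [hr k (h0 k (by simp; omega)) (h0 (k + 1) (by simp; omega)), ih (by omega)]
        exact this l hl.1.le hl.2
      rw [hrl]
      ring
    · push Not at h0
      obtain ⟨k, hk, hk0⟩ := h0
      have hz : (∏ k ∈ Finset.Ico i l, c k) = 0 ∨ (∏ k ∈ Finset.Ico l j, c k) = 0 := by
        rw [Finset.mem_Ico] at hk
        rcases lt_or_ge k l with hkl | hkl
        · exact Or.inl (Finset.prod_eq_zero (Finset.mem_Ico.2 ⟨hk.1, hkl⟩) hk0)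
        · exact Or.inr (Finset.prod_eq_zero (Finset.mem_Ico.2 ⟨hkl, hk.2⟩) hk0)
      rcases hz with hz | hz <;> rw [hz] <;> ring
  rw [Finset.sum_congr rfl hterm, ← Finset.mul_sum]
  simp only [ContinuousMap.smul_apply, smul_eq_mul]
  rw [hmul _ i j hj, hsplit, h1 _ i (hij.le.trans hj), h1 _ j hj]
  ring

lemma sum_Ioo_fin {M : Type*} [AddCommMonoid M] {n : ℕ} (i j : Fin (n + 1)) (f : ℕ → M) :
    ∑ l ∈ Finset.Ioo i j, f l = ∑ l ∈ Finset.Ioo (i : ℕ) j, f l := by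
  rw [← Fin.map_valEmbedding_Ioo, Finset.sum_map]
  rfl

/-- A triangular array satisfying all the equations of a defining system, including the one at the
corner, shows that the Massey product contains zero. -/
lemma zero_mem_masseyProduct {n : ℕ} (hn : 0 < n) {α : Fin n → H1 p G} (a : ℕ → ℕ → C1 p G)
    (hrep : ∀ i : Fin n, Represents (a i (i + 1)) (α i))
    (ha : ∀ i j, i < j → j ≤ n → d1 p G (a i j) = ∑ l ∈ Finset.Ioo i j, cup (a i l) (a l j)) :
    0 ∈ masseyProduct α := by
  have ha' : ∀ i j : Fin (n + 1), i < j →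
      d1 p G (a i j) = ∑ l ∈ Finset.Ioo i j, cup (a i l) (a l j) := by
    intro i j hij
    rw [ha i j hij (by omega), sum_Ioo_fin i j fun l => cup (a i l) (a l j)]
  refine ⟨⟨fun i j => a i j, hrep, fun i j hij _ => ha' i j ?_⟩, ?_⟩
  · rw [Fin.lt_def]
    omega
  · rw [DefiningSystem.value, Submodule.mkQ_apply, Submodule.Quotient.mk_eq_zero]
    exact ⟨a 0 n, ha' 0 (Fin.last n) (Fin.lt_def.2 hn)⟩

/-- Consecutive cup products vanish if a Massey product of length at least three is defined. -/
lemma DefiningSystem.exists_d1_eq_cup {n : ℕ} (hn : 3 ≤ n) {α : Fin n → H1 p G}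
    (M : DefiningSystem α) {i : ℕ} (hi : i + 1 < n) :
    ∃ f, d1 p G f = cup (M.a (⟨i, by omega⟩ : Fin n).castSucc (⟨i, by omega⟩ : Fin n).succ)
      (M.a (⟨i + 1, hi⟩ : Fin n).castSucc (⟨i + 1, hi⟩ : Fin n).succ) := by
  refine ⟨M.a ⟨i, by omega⟩ ⟨i + 2, by omega⟩, ?_⟩
  rw [M.coboundary ⟨i, by omega⟩ ⟨i + 2, by omega⟩ (by simp) ?_]
  · have : Finset.Ioo (⟨i, by omega⟩ : Fin (n + 1)) ⟨i + 2, by omega⟩ = {⟨i + 1, by omega⟩} := by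
      ext l
      simp only [Finset.mem_Ioo, Finset.mem_singleton, Fin.lt_def, Fin.ext_iff]
      omega
    rw [this, Finset.sum_singleton]
    rfl
  · simp only [ne_eq, Prod.mk.injEq, Fin.ext_iff, Fin.val_zero, Fin.val_last]
    omega

end Massey

end MasseyRigid

open MasseyRigid in
theorem mainTheorem2 (p : ℕ) [Fact p.Prime] (hp : Odd p) (n : ℕ) (hn : 3 ≤ n)
    (F : Type*) [Field F] (ζ : F) (hζ : IsPrimitiveRoot ζ p)
    (hF : MasseyRigid.IsRigidField hζ)
    (α : Fin n → MasseyRigid.H1 p (Field.absoluteGaloisGroup F))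
    (hα : MasseyRigid.MasseyDefined α) :
    (0 : MasseyRigid.H2 p (Field.absoluteGaloisGroup F)) ∈ MasseyRigid.masseyProduct α := by
  obtain ⟨M⟩ := hα
  -- The characters, extended by zero to a sequence indexed by `ℕ`.
  let β : ℕ → Z1 p (Field.absoluteGaloisGroup F) := fun i =>
    if h : i < n then ⟨M.a (⟨i, h⟩ : Fin n).castSucc (⟨i, h⟩ : Fin n).succ,
      (M.represents ⟨i, h⟩).1⟩ else 0
  have hβ : ∀ i, ∃ f, d1 p _ f = cup (β i).1 (β (i + 1)).1 := by
    intro i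
    by_cases hi : i + 1 < n
    · simp only [β, dif_pos hi, dif_pos (show i < n by omega)]
      exact M.exists_d1_eq_cup hn hi
    · refine ⟨0, ?_⟩
      simp only [β, dif_neg hi]
      ext x
      simp [cup]
  obtain ⟨r, c, hc, hr⟩ := exists_kummer_scalars hF β hβ
  choose U hU1 hUs hUm using fun a => exists_unipotent_kummer hp hζ a n
  refine zero_mem_masseyProduct (by omega)
    (fun i j => -(∏ l ∈ Finset.Ico i j, c l) • U (r i) i j) (fun i => ?_)
    (fun i j hij hj => d1_prod_smul_eq_sum_cup U hU1 hUm r c hr hij hj)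
  have h : -(∏ l ∈ Finset.Ico (i : ℕ) (i + 1), c l) • U (r i) i (i + 1) = (β i).1 := by
    rw [hc, Nat.Ico_succ_singleton, Finset.prod_singleton]
    ext σ
    change -c i * U (r i) i (i + 1) σ = c i * kummerExponent hζ (r i) σ
    rw [hUs _ _ i.2, neg_mul_neg]
  simp only [h]
  obtain ⟨h1, h2⟩ := M.represents i
  refine ⟨(β i).2, ?_⟩
  rw [← h2]
  exact congrArg _ (dif_pos i.2)
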